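/- **Setting.** Let $d\ge 1$, let $\mathcal X\subset\mathbb R^d$ be an arm set and $\theta_\star\in\mathbb R^d$ an unknown parameter. In each round $t=1,\dots,T$ the learner plays $x_t\in\mathcal X$ and observes $y_t=\langle x_t,\theta_\star\rangle+\eta_t$, where the $\eta_t$ are i.i.d. $N(0,\sigma^2)$, $\sigma>0$. Let $x_\star\in\arg\max_{x\in\mathcal X}\langle x,\theta_\star\rangle$ and $\mathbf R_T=\mathbb E\big[\sum_{t=1}^T\langle x_\star-x_t,\theta_\star\rangle\big]$. A permutation $g$ of $[d]=\{1,\dots,d\}$ acts on $\mathbb R^d$ by $(g\cdot x)_i=x_{g(i)}$. There is a (hidden) subgroup $\mathcal G$ of the symmetric group on $[d]$ with $g\cdot\theta_\star=\theta_\star$ for all $g\in\mathcal G$; let $\pi_{\mathcal G}$ be the partition of $[d]$ into $\mathcal G$-orbits. **Models.** Let $\mathcal Q$ be a collection of partitions of $[d]$ with at most $d_0$ classes, and $\mathcal Q_{k}$ the set of its members with exactly $k$ classes. To a partition $\rho$ we attach the subspace of vectors that are constant on every class of $\rho$ (the fixed-point subspace of any subgroup with orbit partition $\rho$). Let $\mathcal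 M$ be the set of these subspaces for $\rho\in\mathcal Q$, and $\overline{\mathcal M}=\{\mathrm{conv}(m\cup m') : m,m'\in\mathcal M\}=\{m+m' : m,m'\in\mathcal M\}$. Write $\Pi_S$ for the orthogonal projection onto a subspace $S$. **Assumptions.** (1) $\pi_{\mathcal G}\in\mathcal Q$, and $|\mathcal Q_{k}|\le A\,d^{ck}$ for all $1\le k\le d_0$, with constants $A,c>0$. (2) There are $K_x,R>0$ with $\|\Pi_m(x)\|^2\le K_x$ and $|\langle x,\theta_\star\rangle|\le R$ for all $x\in\mathcal X$ and $m\in\overline{\mathcal M}$. **Exploratory distribution.** Let $\nu$ maximise $\lambda_{\min}(\mathbb E_{x\sim\omega}[xx^\top])$ over the probability distributions $\omega$ supported on $\mathcal X$ (with finite second moment), let $C_{\min}$ be the maximal value, and assume $C_{\min}>0$. **Algorithm (Explore-Models-then-Commit) with exploration length $t_1>0$.** Put $n=\min\{\lceil t_1\rceil,T\}$. In rounds $t\le n$, play $x_t$ i.i.d. from $\nu$ (independently of the noise). Let $Y=(y_1,\dots,y_n)^\top$, let $X$ be the matrix with rows $x_1^\top,\dots,x_n^\top$, and for $m\in\mathcal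 M$ let $S_m\subset\mathbb R^n$ be the column space of the matrix with rows $\Pi_m(x_t)^\top$, $t\le n$. Select $\widehat m\in\arg\min_{m\in\mathcal M}\|Y-\Pi_{S_m}Y\|^2$ and $\widehat\theta\in\arg\min_{\theta\in\widehat m}\|Y-X\theta\|^2$, and in rounds $n<t\le T$ play $x_t\in\arg\max_{x\in\mathcal X}\langle\widehat\theta,x\rangle$ (the argmax is assumed to be attained; ties are broken arbitrarily). **Theorem.** For all $A,c>0$ there are constants $C_0,C_1>0$, depending only on $A$ and $c$, such that the following holds in every instance as above with $dT\ge 2$. Let $$t_1=R^{-2/3}\sigma^{2/3}C_{\min}^{-1/3}K_x^{1/3}d_0^{1/3}T^{2/3}(\log(dT))^{1/3},$$ and suppose that $T$ is large enough that $t_1\ge C_0\,K_x^2\,d_0\,C_{\min}^{-2}\log(dT)$. (For fixed values of the other parameters this holds for all sufficiently large $T$.) Then the regret of Explore-Models-then-Commit with exploration length $t_1$ is integrable and satisfies $$\mathbf R_T\le C_1\,R^{1/3}\sigma^{2/3}C_{\min}^{-1/3}K_x^{1/3}d_0^{1/3}T^{2/3}(\log(dT))^{1/3}.$$ -/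

import Mathlib

open MeasureTheory ProbabilityTheory

namespace SymBandit

/-- The space `ℝ^d` with its Euclidean structure. -/
abbrev Vec (d : ℕ) : Type := EuclideanSpace ℝ (Fin d)

/-! ### Coordinate permutations, partitions and fixed-point subspaces -/

/-- The action of a permutation on `ℝ^d` by `(g · x) i = x (g i)`. -/
noncomputable def permAct {d : ℕ} (g : Equiv.Perm (Fin d)) (x : Vec d) : Vec d :=
  WithLp.toLp 2 (fun i => x (g i))

/-- The fixed-point subspace of a subgroup `G` of the symmetric group. -/
def fixedSubspace {d : ℕ} (G : Subgroup (Equiv.Perm (Fin d))) : Submodule ℝ (Vec d) where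
  carrier := {x | ∀ g ∈ G, permAct g x = x}
  add_mem' := by
    intro a b ha hb g hg
    have h1 := ha g hg
    have h2 := hb g hg
    ext i
    have e1 := congrArg (fun v : Vec d => v i) h1
    have e2 := congrArg (fun v : Vec d => v i) h2
    simp only [permAct] at e1 e2 ⊢
    simp [e1, e2]
  zero_mem' := by
    intro g _
    ext i
    simp [permAct]
  smul_mem' := by
    intro c a ha g hg
    have h1 := ha g hg
    ext i
    have e1 := congrArg (fun v : Vec d => v i) h1
    simp only [permAct] at e1 ⊢
    simp [e1]

/-- The number of classes of a partition of `{1, …, d}`, given as an equivalence relation. -/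
noncomputable def numClasses {d : ℕ} (r : Setoid (Fin d)) : ℕ := Nat.card (Quotient r)

/-- The partition of `{1, …, d}` into orbits of a subgroup `G`. -/
def orbitPartition {d : ℕ} (G : Subgroup (Equiv.Perm (Fin d))) : Setoid (Fin d) :=
  MulAction.orbitRel G (Fin d)

/-- The subspace attached to a partition: the vectors that are constant on each class. It is the
fixed-point subspace of every subgroup whose orbit partition it is, see
`fixedSubspace_eq_partitionSubspace`. -/
def partitionSubspace {d : ℕ} (r : Setoid (Fin d)) : Submodule ℝ (Vec d) where
  carrier := {x | ∀ i j, r i j → x i = x j}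
  add_mem' := by
    intro a b ha hb i j h
    simp [ha i j h, hb i j h]
  zero_mem' := by
    intro i j _
    simp
  smul_mem' := by
    intro c a ha i j h
    simp [ha i j h]

theorem fixedSubspace_eq_partitionSubspace {d : ℕ} (G : Subgroup (Equiv.Perm (Fin d))) :
    fixedSubspace G = partitionSubspace (orbitPartition G) := by
  ext x
  constructor
  · intro h i j hij
    obtain ⟨g, hg⟩ := MulAction.orbitRel_apply.mp hij
    have e := congrArg (fun v : Vec d => v j) (h g.1 g.2)
    have hg' : (g : Equiv.Perm (Fin d)) j = i := hg
    simp only [permAct, hg'] at e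
    exact e
  · intro h g hg
    ext i
    exact h (g i) i (MulAction.orbitRel_apply.mpr ⟨⟨g, hg⟩, rfl⟩)

/-- The collection of models attached to a collection `Q` of partitions. -/
def models {d : ℕ} (Q : Set (Setoid (Fin d))) : Set (Submodule ℝ (Vec d)) :=
  partitionSubspace '' Q

/-- The convex hull of the union of two subspaces is their sum. -/
theorem convexHull_union_eq_sup {d : ℕ} (m m' : Submodule ℝ (Vec d)) :
    convexHull ℝ ((m : Set (Vec d)) ∪ (m' : Set (Vec d))) = ((m ⊔ m' : Submodule ℝ (Vec d)) :
      Set (Vec d)) := by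
  apply Set.Subset.antisymm
  · refine convexHull_min ?_ (m ⊔ m').convex
    rintro x (hx | hx)
    · exact Submodule.mem_sup_left hx
    · exact Submodule.mem_sup_right hx
  · intro x hx
    obtain ⟨a, ha, b, hb, rfl⟩ := Submodule.mem_sup.mp hx
    have h1 : (2 : ℝ) • a ∈ convexHull ℝ ((m : Set (Vec d)) ∪ (m' : Set (Vec d))) :=
      subset_convexHull ℝ _ (Or.inl (m.smul_mem 2 ha))
    have h2 : (2 : ℝ) • b ∈ convexHull ℝ ((m : Set (Vec d)) ∪ (m' : Set (Vec d))) :=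
      subset_convexHull ℝ _ (Or.inr (m'.smul_mem 2 hb))
    have h3 := convex_convexHull ℝ ((m : Set (Vec d)) ∪ (m' : Set (Vec d))) h1 h2
      (by norm_num : (0 : ℝ) ≤ 1 / 2) (by norm_num : (0 : ℝ) ≤ 1 / 2) (by norm_num)
    have e : (1 / 2 : ℝ) • (2 : ℝ) • a + (1 / 2 : ℝ) • (2 : ℝ) • b = a + b := by
      simp [smul_smul]
    rwa [e] at h3

/-- The extended collection: all subspaces `conv (m ∪ m') = m + m'` with `m`, `m'` in the
collection. -/
def extendedModels {d : ℕ} (M : Set (Submodule ℝ (Vec d))) : Set (Submodule ℝ (Vec d)) :=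
  {p | ∃ m ∈ M, ∃ m' ∈ M, p = m ⊔ m'}

/-! ### Exploratory distributions -/

/-- The matrix `E[x xᵀ]` for `x` distributed according to `ω`. -/
noncomputable def secondMoment {d : ℕ} (ω : Measure (Vec d)) : Matrix (Fin d) (Fin d) ℝ :=
  Matrix.of fun i j => ∫ x, x i * x j ∂ω

/-- The smallest eigenvalue of a symmetric matrix. -/
noncomputable def lambdaMin {d : ℕ} (A : Matrix (Fin d) (Fin d) ℝ) : ℝ := sInf (spectrum ℝ A)

/-- Probability measures carried by the arm set for which `E[x xᵀ]` exists. -/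
structure IsArmDistribution {d : ℕ} (X : Set (Vec d)) (ω : Measure (Vec d)) : Prop where
  isProbabilityMeasure : IsProbabilityMeasure ω
  supported : ∀ᵐ x ∂ω, x ∈ X
  memLp_two : MemLp (fun x : Vec d => x) 2 ω

/-- `ν` maximises `λ_min (E[x xᵀ])` among the distributions on the arm set. -/
structure IsExploratory {d : ℕ} (X : Set (Vec d)) (ν : Measure (Vec d)) : Prop where
  isArmDistribution : IsArmDistribution X ν
  isMax : ∀ ω : Measure (Vec d), IsArmDistribution X ω →
    lambdaMin (secondMoment ω) ≤ lambdaMin (secondMoment ν)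

/-! ### Least squares and model selection -/

/-- The linear map `θ ↦ (⟨x_t, θ⟩)_t` of the design matrix with rows `x_t`. -/
noncomputable def design {d n : ℕ} (x : Fin n → Vec d) : Vec d →ₗ[ℝ] Vec n where
  toFun θ := WithLp.toLp 2 (fun t => inner ℝ (x t) θ)
  map_add' := by
    intro a b
    ext t
    simp [inner_add_right]
  map_smul' := by
    intro c a
    ext t
    simp [inner_smul_right]

/-- The column space `S_m` of the design matrix whose rows are the projections `Π_m (x_t)`. -/
noncomputable def colSpace {d n : ℕ} (m : Submodule ℝ (Vec d)) (x : Fin n → Vec d) :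
    Submodule ℝ (Vec n) :=
  LinearMap.range (design (fun t => m.starProjection (x t)))

/-- The fitted vector of the model `m`: the projection of the observations on `S_m`. -/
noncomputable def fitted {d n : ℕ} (m : Submodule ℝ (Vec d)) (x : Fin n → Vec d) (Y : Vec n) :
    Vec n :=
  (colSpace m x).starProjection Y

/-- `mhat` minimises the least square error `‖Y - fitted m‖²` over the collection `M`. -/
def IsSelectedModel {d n : ℕ} (M : Set (Submodule ℝ (Vec d))) (x : Fin n → Vec d) (Y : Vec n)
    (mhat : Submodule ℝ (Vec d)) : Prop :=
  mhat ∈ M ∧ ∀ m ∈ M, ‖Y - fitted mhat x Y‖ ^ 2 ≤ ‖Y - fitted m x Y‖ ^ 2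

/-- `θhat` minimises `‖Y - X θ‖²` over the subspace `m`. -/
def IsLeastSquares {d n : ℕ} (m : Submodule ℝ (Vec d)) (x : Fin n → Vec d) (Y : Vec n)
    (θhat : Vec d) : Prop :=
  θhat ∈ m ∧ ∀ θ ∈ m, ‖Y - design x θhat‖ ^ 2 ≤ ‖Y - design x θ‖ ^ 2

/-! ### The algorithm -/

/-- The observations `y_t = ⟨x_t, θ⟩ + η_t` of the first `n` rounds, for the outcome `w`. -/
noncomputable def observations {d : ℕ} {Ω : Type*} (n : ℕ) (x : ℕ → Ω → Vec d) (η : ℕ → Ω → ℝ)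
    (θ : Vec d) (w : Ω) : Vec n :=
  WithLp.toLp 2 (fun t : Fin n => inner ℝ (x t w) θ + η t w)

/-- `x` is the sequence of arms played by Explore-Models-then-Commit during `T` rounds (numbered
`0, …, T - 1`) with `n` exploration rounds, noise `η`, parameter `θ`, arm set `X`, collection of
models `M`, exploratory distribution `ν` and noise level `σ`. The selected model, the
least-squares estimate and the greedy arms are any minimisers and maximisers: no tie-breaking rule
is prescribed. -/
structure IsEMCRun {d : ℕ} {Ω : Type*} [MeasurableSpace Ω] (P : Measure Ω) (X : Set (Vec d))
    (M : Set (Submodule ℝ (Vec d))) (ν : Measure (Vec d)) (θ : Vec d) (σ : ℝ) (T n : ℕ)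
    (x : ℕ → Ω → Vec d) (η : ℕ → Ω → ℝ) (mhat : Ω → Submodule ℝ (Vec d)) (θhat : Ω → Vec d) :
    Prop where
  measurable_arm : ∀ t < T, Measurable (x t)
  measurable_noise : ∀ t < T, Measurable (η t)
  noise_law : ∀ t < T, P.map (η t) = gaussianReal 0 (Real.toNNReal (σ ^ 2))
  noise_indep : iIndepFun (fun t : Fin T => η t) P
  explore_law : ∀ t < n, P.map (x t) = ν
  explore_indep : iIndepFun (fun t : Fin n => x t) P
  explore_indep_noise :
    IndepFun (fun w (t : Fin n) => x t w) (fun w (t : Fin T) => η t w) P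
  selected : ∀ᵐ w ∂P,
    IsSelectedModel M (fun t : Fin n => x t w) (observations n x η θ w) (mhat w)
  estimate : ∀ᵐ w ∂P,
    IsLeastSquares (mhat w) (fun t : Fin n => x t w) (observations n x η θ w) (θhat w)
  greedy : ∀ t, n ≤ t → t < T → ∀ᵐ w ∂P,
    x t w ∈ X ∧ ∀ z ∈ X, inner ℝ (θhat w) z ≤ inner ℝ (θhat w) (x t w)

/-- The (random) regret `∑_t ⟨x⋆ - x_t, θ⟩` accumulated over `T` rounds. -/
noncomputable def pseudoRegret {d : ℕ} {Ω : Type*} (T : ℕ) (xstar θ : Vec d)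
    (x : ℕ → Ω → Vec d) (w : Ω) : ℝ :=
  ∑ t ∈ Finset.range T, inner ℝ (xstar - x t w) θ

/-- The exploration length (before rounding)
`R^(-2/3) σ^(2/3) C^(-1/3) K^(1/3) d₀^(1/3) T^(2/3) (log (d T))^(1/3)`. -/
noncomputable def explorationLength (R σ C K : ℝ) (d₀ d T : ℕ) : ℝ :=
  R ^ (-(2 / 3) : ℝ) * σ ^ (2 / 3 : ℝ) * C ^ (-(1 / 3) : ℝ) * K ^ (1 / 3 : ℝ) *
    (d₀ : ℝ) ^ (1 / 3 : ℝ) * (T : ℝ) ^ (2 / 3 : ℝ) *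
    (Real.log ((d : ℝ) * (T : ℝ))) ^ (1 / 3 : ℝ)

/-- The regret rate
`R^(1/3) σ^(2/3) C^(-1/3) K^(1/3) d₀^(1/3) T^(2/3) (log (d T))^(1/3)`. -/
noncomputable def regretRate (R σ C K : ℝ) (d₀ d T : ℕ) : ℝ :=
  R ^ (1 / 3 : ℝ) * σ ^ (2 / 3 : ℝ) * C ^ (-(1 / 3) : ℝ) * K ^ (1 / 3 : ℝ) *
    (d₀ : ℝ) ^ (1 / 3 : ℝ) * (T : ℝ) ^ (2 / 3 : ℝ) *
    (Real.log ((d : ℝ) * (T : ℝ))) ^ (1 / 3 : ℝ)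

end SymBandit

/-! Let `v` be the estimation error `θhat - θ`. Selecting a model and then fitting it minimises the
residual over the union of all models, which contains the true parameter. Comparing residuals gives
the basic inequality `∑ ⟨x_t, v⟩² ≤ 2 ∑ ε_t ⟨x_t, v⟩` (`sum_inner_sq_le_of_isSelectedModel`). The
selected model is random, but `v` always lies in one of the sums (true model) + (candidate model),
each of dimension at most `2 d₀`.

On such a sum, put the norm `‖L v‖` of `⟨·, v⟩` in `L²(ν)`, which dominates `√Cmin ‖v‖`, and take a
half-net of at most `5 ^ (2 d₀)` points. Hoeffding's inequality on pairs of net points makes the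
left side at least `n/2 · ‖L v‖²`. A Gaussian tail bound, given the design, makes the right side at
most `4 s ‖L v‖`. Hence `‖L v‖ ≤ 8 s / n`. The union bound runs over nets and over at most `A exp
((c + 1) d₀ log (dT))` models, which is affordable when `s² ≍ n σ² d₀ log (dT)` and `n` exceeds a
multiple of `(K/Cmin)² d₀ log (dT)`.

Every arm then satisfies `|⟨z, v⟩| ≤ ρ := √K · 8 s / (n √Cmin)`, so a greedy round costs at most
`2ρ`. The regret is at most `2 R n + 2 ρ T` plus a term of order `R` from the bad event, and `t₁`
balances the first two. -/

namespace SymBandit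

/-! ### Half-nets -/

open Module in
/-- The unit ball of a finite-dimensional normed space has a `1/2`-net of at most `5 ^ dim`
points. -/
theorem exists_half_net (E : Type*) [NormedAddCommGroup E] [NormedSpace ℝ E]
    [FiniteDimensional ℝ E] :
    ∃ N : Finset E, N.card ≤ 5 ^ finrank ℝ E ∧ (∀ w ∈ N, ‖w‖ ≤ 1) ∧
      ∀ u, ‖u‖ ≤ 1 → ∃ w ∈ N, ‖u - w‖ ≤ 1 / 2 := by
  classical
  -- A `1/2`-separated subset of the ball of maximal cardinality is a `1/2`-net.
  let Sep : Finset E → Prop := fun N =>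
    (∀ w ∈ N, ‖w‖ ≤ 1) ∧ ∀ w ∈ N, ∀ w' ∈ N, w ≠ w' → 1 / 2 ≤ ‖w - w'‖
  have hcard : ∀ N, Sep N → N.card ≤ 5 ^ finrank ℝ E := by
    intro N hN
    have hinj : Function.Injective (fun w : E => (2 : ℝ) • w) :=
      smul_right_injective E (two_ne_zero)
    -- Doubling the points puts them in the ball of radius 2 with mutual distances at least 1, as
    -- the `5 ^ dim` bound requires.
    rw [← Finset.card_image_of_injective N hinj]
    refine Besicovitch.card_le_of_separated _ ?_ ?_
    · intro y hy
      obtain ⟨w, hw, rfl⟩ := Finset.mem_image.mp hy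
      have := hN.1 w hw
      rw [norm_smul, Real.norm_eq_abs, abs_of_pos (by norm_num : (0 : ℝ) < 2)]
      linarith
    · intro y hy y' hy' hne
      obtain ⟨w, hw, rfl⟩ := Finset.mem_image.mp hy
      obtain ⟨w', hw', rfl⟩ := Finset.mem_image.mp hy'
      have := hN.2 w hw w' hw' (fun h => hne (by rw [h]))
      simp only [← smul_sub]
      rw [norm_smul, Real.norm_eq_abs, abs_of_pos (by norm_num : (0 : ℝ) < 2)]
      linarith
  let S : Set ℕ := {k | ∃ N, Sep N ∧ N.card = k}
  have hne : S.Nonempty := ⟨0, ∅, ⟨by simp, by simp⟩, rfl⟩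
  have hbdd : BddAbove S := ⟨_, by rintro k ⟨N, hN, rfl⟩; exact hcard N hN⟩
  obtain ⟨N, hN, hmax⟩ := Nat.sSup_mem hne hbdd
  refine ⟨N, hcard N hN, hN.1, fun u hu => ?_⟩
  by_contra! h
  have huN : u ∉ N := fun huN => by
    have := h u huN
    simp at this
    linarith
  have hsep : Sep (insert u N) := by
    refine ⟨?_, ?_⟩
    · intro w hw
      rcases Finset.mem_insert.mp hw with rfl | hw
      · exact hu
      · exact hN.1 w hw
    · intro w hw w' hw' hne
      rcases Finset.mem_insert.mp hw with h1 | h1 <;>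
        rcases Finset.mem_insert.mp hw' with h2 | h2
      · exact absurd (h1.trans h2.symm) hne
      · exact h1 ▸ (h w' h2).le
      · rw [norm_sub_rev]
        exact h2 ▸ (h w h1).le
      · exact hN.2 w h1 w' h2 hne
  have h1 : (insert u N).card ≤ sSup S := le_csSup hbdd ⟨_, hsep, rfl⟩
  rw [Finset.card_insert_of_notMem huN, ← hmax] at h1
  omega

/-- A finite set `N` is a half-net of the subspace `S` for the seminorm `v ↦ ‖L v‖`. -/
structure IsHalfNet {V F : Type*} [AddCommGroup V] [Module ℝ V] [NormedAddCommGroup F]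
    [NormedSpace ℝ F] (L : V →ₗ[ℝ] F) (S : Submodule ℝ V) (N : Finset V) : Prop where
  mem : ∀ w ∈ N, w ∈ S
  norm_le : ∀ w ∈ N, ‖L w‖ ≤ 1
  exists_near : ∀ u ∈ S, ‖L u‖ ≤ 1 → ∃ w ∈ N, ‖L (u - w)‖ ≤ 1 / 2

-- The net is built in the image of `S` under `L`, where the seminorm is a true norm, and pulled
-- back; the dimension cannot increase.
open Module in
theorem exists_isHalfNet {V F : Type*} [AddCommGroup V] [Module ℝ V] [NormedAddCommGroup F]
    [NormedSpace ℝ F] (L : V →ₗ[ℝ] F) (S : Submodule ℝ V) [FiniteDimensional ℝ S] :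
    ∃ N : Finset V, N.card ≤ 5 ^ finrank ℝ S ∧ IsHalfNet L S N := by
  classical
  obtain ⟨N, hcard, hle, hnear⟩ := exists_half_net (S.map L)
  have hpre : ∀ y : S.map L, ∃ v ∈ S, L v = y := fun y => Submodule.mem_map.mp y.2
  choose f hfS hf using hpre
  refine ⟨N.image f, ?_, ?_, ?_, ?_⟩
  · refine Finset.card_image_le.trans (hcard.trans ?_)
    exact Nat.pow_le_pow_right (by norm_num) (Submodule.finrank_map_le L S)
  · intro w hw
    obtain ⟨y, -, rfl⟩ := Finset.mem_image.mp hw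
    exact hfS y
  · intro w hw
    obtain ⟨y, hy, rfl⟩ := Finset.mem_image.mp hw
    rw [hf]
    exact hle y hy
  · intro u hu hu1
    obtain ⟨y, hy, hyu⟩ := hnear ⟨L u, Submodule.mem_map_of_mem hu⟩ hu1
    refine ⟨f y, Finset.mem_image_of_mem f hy, ?_⟩
    rw [map_sub, hf]
    exact hyu

section

variable {V F : Type*} [NormedAddCommGroup V] [NormedSpace ℝ V] [FiniteDimensional ℝ V]
  [NormedAddCommGroup F] [NormedSpace ℝ F] {L : V →ₗ[ℝ] F} {S : Submodule ℝ V} {N : Finset V}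

/-- A linear form bounded on a half-net is bounded on the whole subspace. -/
theorem IsHalfNet.abs_apply_le (hN : IsHalfNet L S N) {κ : ℝ} (hκ : 0 < κ)
    (hL : ∀ v, κ * ‖v‖ ≤ ‖L v‖) (f : V →ₗ[ℝ] ℝ) {s : ℝ} (hs : 0 ≤ s)
    (hf : ∀ w ∈ N, |f w| ≤ s) {u : V} (hu : u ∈ S) : |f u| ≤ 2 * s * ‖L u‖ := by
  obtain ⟨b, hb0, hb⟩ : ∃ b : ℝ, 0 ≤ b ∧ ∀ v, |f v| ≤ b * ‖L v‖ := by
    refine ⟨‖LinearMap.toContinuousLinearMap f‖ / κ, by positivity, fun v => ?_⟩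
    calc |f v| ≤ ‖LinearMap.toContinuousLinearMap f‖ * ‖v‖ :=
          (LinearMap.toContinuousLinearMap f).le_opNorm v
      _ ≤ ‖LinearMap.toContinuousLinearMap f‖ * (‖L v‖ / κ) := by
          gcongr
          rw [le_div_iff₀ hκ, mul_comm]
          exact hL v
      _ = _ := by ring
  -- Iterated approximation: a normalised vector is a net point plus a remainder of seminorm at most
  -- `1/2`, so a bound with constant `a` improves to `s + a / 2`. The fixed point is `2 s`; the
  -- crude constant `b` only starts the iteration.
  have step : ∀ k : ℕ, ∀ v ∈ S, |f v| ≤ (2 * s + b * (1 / 2) ^ k) * ‖L v‖ := by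
    intro k
    induction k with
    | zero =>
      intro v _
      refine (hb v).trans ?_
      gcongr
      simpa using hs
    | succ k ih =>
      intro v hv
      rcases eq_or_lt_of_le (norm_nonneg (L v)) with h0 | hpos
      · have := hb v
        rw [← h0] at this ⊢
        simpa using this
      · set r := ‖L v‖ with hr
        have hv1 : ‖L (r⁻¹ • v)‖ ≤ 1 := by
          rw [map_smul, norm_smul, norm_inv, Real.norm_of_nonneg hpos.le, ← hr,
            inv_mul_cancel₀ hpos.ne']
        obtain ⟨w, hw, hnear⟩ := hN.exists_near _ (S.smul_mem r⁻¹ hv) hv1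
        have h1 := ih _ (S.sub_mem (S.smul_mem r⁻¹ hv) (hN.mem w hw))
        have h2 : |f (r⁻¹ • v)| ≤ s + (2 * s + b * (1 / 2) ^ k) * (1 / 2) := by
          calc |f (r⁻¹ • v)| = |f w + f (r⁻¹ • v - w)| := by rw [map_sub]; ring_nf
            _ ≤ |f w| + |f (r⁻¹ • v - w)| := abs_add_le _ _
            _ ≤ s + (2 * s + b * (1 / 2) ^ k) * (1 / 2) := by
              refine add_le_add (hf w hw) (h1.trans ?_)
              gcongr
        rw [map_smul, smul_eq_mul, abs_mul, abs_of_pos (inv_pos.mpr hpos),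
          inv_mul_le_iff₀ hpos] at h2
        calc |f v| ≤ _ := h2
          _ = _ := by ring
  have hlim : Filter.Tendsto (fun k : ℕ => (2 * s + b * (1 / 2) ^ k) * ‖L u‖) Filter.atTop
      (nhds ((2 * s + b * 0) * ‖L u‖)) :=
    ((tendsto_pow_atTop_nhds_zero_of_lt_one (by norm_num) (by norm_num)).const_mul b
      |>.const_add _).mul_const _
  have := ge_of_tendsto' hlim (fun k => step k u hu)
  simpa using this

/-- A bilinear form bounded on the pairs of a half-net is bounded on the whole subspace. -/
theorem IsHalfNet.abs_bilin_le (hN : IsHalfNet L S N) {κ : ℝ} (hκ : 0 < κ)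
    (hL : ∀ v, κ * ‖v‖ ≤ ‖L v‖) (B : V →ₗ[ℝ] V →ₗ[ℝ] ℝ) {s : ℝ} (hs : 0 ≤ s)
    (hB : ∀ w ∈ N, ∀ w' ∈ N, |B w w'| ≤ s) {u : V} (hu : u ∈ S) :
    |B u u| ≤ 4 * s * ‖L u‖ ^ 2 := by
  -- The linear bound is applied in each variable in turn, at the price of a factor 2 each time.
  have h1 : ∀ w ∈ N, |B.flip u w| ≤ 2 * s * ‖L u‖ := fun w hw =>
    hN.abs_apply_le hκ hL (B w) hs (hB w hw) hu
  have h2 := hN.abs_apply_le hκ hL (B.flip u) (by positivity) h1 hu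
  calc |B u u| = |B.flip u u| := rfl
    _ ≤ _ := h2
    _ = _ := by ring

end

/-! ### Deviation inequalities -/

section

variable {Ω : Type*} [MeasurableSpace Ω] {P : Measure Ω}

theorem measureReal_abs_ge_le_of_hasSubgaussianMGF [IsFiniteMeasure P] {Z : Ω → ℝ} {v : NNReal}
    (h : HasSubgaussianMGF Z v P) {s : ℝ} (hs : 0 ≤ s) :
    P.real {w | s ≤ |Z w|} ≤ 2 * Real.exp (-s ^ 2 / (2 * v)) := by
  have h1 := h.measure_ge_le hs
  have h2 := h.neg.measure_ge_le hs
  have hsub : {w | s ≤ |Z w|} ⊆ {w | s ≤ Z w} ∪ {w | s ≤ (-Z) w} := by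
    intro w hw
    have hw' : s ≤ |Z w| := hw
    rcases le_abs.mp hw' with h | h
    · exact Or.inl h
    · exact Or.inr h
  calc P.real {w | s ≤ |Z w|} ≤ P.real ({w | s ≤ Z w} ∪ {w | s ≤ (-Z) w}) :=
        measureReal_mono hsub
    _ ≤ P.real {w | s ≤ Z w} + P.real {w | s ≤ (-Z) w} := measureReal_union_le _ _
    _ ≤ 2 * Real.exp (-s ^ 2 / (2 * v)) := by linarith

/-- Hoeffding's inequality for a bounded function of i.i.d. variables. -/
theorem measureReal_abs_sum_sub_integral_ge_le [IsProbabilityMeasure P] {E : Type*}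
    [MeasurableSpace E] {ν : Measure E} {n : ℕ} {x : Fin n → Ω → E}
    (hx : ∀ t, Measurable (x t)) (hlaw : ∀ t, P.map (x t) = ν) (hind : iIndepFun x P)
    {g : E → ℝ} (hg : Measurable g) {b : ℝ} (hb : 0 < b) (hgb : ∀ᵐ z ∂ν, |g z| ≤ b)
    {r : ℝ} (hr : 0 ≤ r) :
    P.real {w | n * r ≤ |∑ t, g (x t w) - n * ∫ z, g z ∂ν|} ≤
      2 * Real.exp (-(n * (r ^ 2 / (2 * b ^ 2)))) := by
  have hsub : ∀ t, HasSubgaussianMGF (fun w => g (x t w) - ∫ z, g z ∂ν) ((‖b - (-b)‖₊ / 2) ^ 2)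
      P := by
    intro t
    have hae : ∀ᵐ w ∂P, g (x t w) ∈ Set.Icc (-b) b := by
      have := ae_of_ae_map (hx t).aemeasurable ((hlaw t).symm ▸ hgb)
      filter_upwards [this] with w hw using abs_le.mp hw
    have hmean : P[fun w => g (x t w)] = ∫ z, g z ∂ν := by
      rw [← hlaw t, integral_map (hx t).aemeasurable hg.aestronglyMeasurable]
    have := hasSubgaussianMGF_of_mem_Icc (hg.comp (hx t)).aemeasurable hae
    rw [← hmean]
    exact this
  have hind' : iIndepFun (fun t w => g (x t w) - ∫ z, g z ∂ν) P :=
    hind.comp (fun _ z => g z - ∫ z, g z ∂ν) (fun _ => hg.sub_const _)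
  have hsum := HasSubgaussianMGF.sum_of_iIndepFun hind' (s := Finset.univ)
    (fun t _ => hsub t)
  have h := measureReal_abs_ge_le_of_hasSubgaussianMGF hsum (s := n * r) (by positivity)
  simp only [Finset.sum_sub_distrib, Finset.sum_const, Finset.card_univ, Fintype.card_fin,
    nsmul_eq_mul] at h
  refine h.trans (le_of_eq ?_)
  congr 2
  have hbb : ((‖b - (-b)‖₊ / 2 : NNReal) : ℝ) = b := by
    rw [NNReal.coe_div, coe_nnnorm, Real.norm_eq_abs, abs_of_pos (by linarith)]
    push_cast
    ring
  push_cast at hbb ⊢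
  rw [hbb]
  rcases Nat.eq_zero_or_pos n with rfl | hn
  · simp
  · have : (n : ℝ) ≠ 0 := by positivity
    field_simp

theorem hasSubgaussianMGF_of_map_eq_gaussianReal {Z : Ω → ℝ} {v : NNReal}
    (hZ : Measurable Z) (h : P.map Z = gaussianReal 0 v) : HasSubgaussianMGF Z v P := by
  rw [← HasSubgaussianMGF.id_map_iff hZ.aemeasurable, h]
  refine ⟨fun t => integrable_exp_mul_gaussianReal t, fun t => ?_⟩
  rw [mgf_id_gaussianReal]
  simp

/-- Deviations of a linear combination of i.i.d. Gaussian variables with independent random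
coefficients. -/
theorem measureReal_abs_sum_mul_ge_le [IsProbabilityMeasure P] {E : Type*} [MeasurableSpace E]
    {n : ℕ} {x : Fin n → Ω → E} {η : Fin n → Ω → ℝ} {v : NNReal}
    (hx : ∀ t, Measurable (x t)) (hη : ∀ t, Measurable (η t))
    (hlaw : ∀ t, P.map (η t) = gaussianReal 0 v) (hind : iIndepFun η P)
    (hxη : IndepFun (fun w t => x t w) (fun w t => η t w) P)
    {g : E → ℝ} (hg : Measurable g) {s V : ℝ} (hs : 0 ≤ s) (hv : 0 < v) :
    P.real {w | ∑ t, g (x t w) ^ 2 ≤ V ∧ s ≤ |∑ t, η t w * g (x t w)|} ≤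
      2 * Real.exp (-s ^ 2 / (2 * (V * v))) := by
  let A : Set ((Fin n → E) × (Fin n → ℝ)) :=
    {p | ∑ t, g (p.1 t) ^ 2 ≤ V ∧ s ≤ |∑ t, p.2 t * g (p.1 t)|}
  have hgm : ∀ t, Measurable fun p : (Fin n → E) × (Fin n → ℝ) => g (p.1 t) := fun t =>
    hg.comp ((measurable_pi_apply t).comp measurable_fst)
  have hA : MeasurableSet A := by
    refine MeasurableSet.inter ?_ ?_
    · exact measurableSet_le (Finset.measurable_sum _ fun t _ => (hgm t).pow_const 2)
        measurable_const
    · exact measurableSet_le measurable_const (Finset.measurable_sum _ fun t _ =>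
        ((measurable_pi_apply t).comp measurable_snd).mul (hgm t)).abs
  have hxm : Measurable fun w t => x t w := measurable_pi_lambda _ hx
  have hηm : Measurable fun w t => η t w := measurable_pi_lambda _ hη
  have hprod := (indepFun_iff_map_prod_eq_prod_map_map hxm.aemeasurable hηm.aemeasurable).mp hxη
  set B := 2 * Real.exp (-s ^ 2 / (2 * (V * v))) with hB
  have hB0 : 0 ≤ B := by positivity
  -- By independence the design can be frozen at `a`; the noise sum is then sub-Gaussian with
  -- variance proxy `v ∑ g (a t)² ≤ v V`. Integrating over the law of the design concludes.
  have key : ∀ a : Fin n → E, (P.map fun w t => η t w) (Prod.mk a ⁻¹' A) ≤ ENNReal.ofReal B := by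
    intro a
    rw [Measure.map_apply hηm (measurable_prodMk_left hA)]
    by_cases ha : ∑ t, g (a t) ^ 2 ≤ V
    · have hsub : ∀ t, HasSubgaussianMGF (fun w => g (a t) * η t w)
          (⟨g (a t) ^ 2, sq_nonneg _⟩ * v) P := fun t =>
        (hasSubgaussianMGF_of_map_eq_gaussianReal (hη t) (hlaw t)).const_mul _
      have hind' : iIndepFun (fun t w => g (a t) * η t w) P :=
        hind.comp (fun t z => g (a t) * z) (fun t => measurable_const_mul _)
      have hsum := HasSubgaussianMGF.sum_of_iIndepFun hind' (s := Finset.univ)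
        (fun t _ => hsub t)
      have h := measureReal_abs_ge_le_of_hasSubgaussianMGF hsum hs
      have hset : (fun w t => η t w) ⁻¹' (Prod.mk a ⁻¹' A) ⊆
          {w | s ≤ |∑ t, g (a t) * η t w|} := by
        rintro w ⟨-, hw⟩
        simpa only [Set.mem_ofPred_eq, mul_comm] using hw
      rw [← ofReal_measureReal]
      refine ENNReal.ofReal_le_ofReal ((measureReal_mono hset).trans ?_)
      -- When all coefficients vanish the variance proxy is zero and the tail formula says nothing,
      -- so this case is treated directly.
      rcases eq_or_lt_of_le (Finset.sum_nonneg fun t (_ : t ∈ Finset.univ) =>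
        sq_nonneg (g (a t))) with h0 | hpos
      · have hz : ∀ t, g (a t) = 0 := fun t => by
          have := (Finset.sum_eq_zero_iff_of_nonneg
            (fun t (_ : t ∈ Finset.univ) => sq_nonneg (g (a t)))).mp h0.symm t (Finset.mem_univ t)
          exact pow_eq_zero_iff (two_ne_zero) |>.mp this
        rcases eq_or_lt_of_le hs with rfl | hs
        · rw [hB]
          refine measureReal_le_one.trans ?_
          simp
        · have : {w | s ≤ |∑ t, g (a t) * η t w|} = ∅ := by
            ext w
            simp [hz, hs]
          rw [this]
          simpa using hB0
      · refine h.trans ?_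
        rw [hB]
        gcongr ?_ * Real.exp ?_
        rw [neg_div, neg_div, neg_le_neg_iff]
        push_cast
        have e : ∑ t, g (a t) ^ 2 * (v : ℝ) = (∑ t, g (a t) ^ 2) * v := by
          rw [Finset.sum_mul]
        have hv' : (0 : ℝ) < v := hv
        change s ^ 2 / (2 * (V * v)) ≤ s ^ 2 / (2 * ∑ t, g (a t) ^ 2 * (v : ℝ))
        rw [e]
        gcongr
    · have : (fun w t => η t w) ⁻¹' (Prod.mk a ⁻¹' A) = ∅ := by
        ext w
        simp only [Set.mem_preimage, Set.mem_empty_iff_false, iff_false]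
        exact fun h => ha h.1
      rw [this]
      simp
  have hfin : P {w | ∑ t, g (x t w) ^ 2 ≤ V ∧ s ≤ |∑ t, η t w * g (x t w)|} ≤
      ENNReal.ofReal B := by
    have e : {w | ∑ t, g (x t w) ^ 2 ≤ V ∧ s ≤ |∑ t, η t w * g (x t w)|} =
        (fun w => ((fun t => x t w), (fun t => η t w))) ⁻¹' A := rfl
    have : IsProbabilityMeasure (P.map fun w t => η t w) :=
      Measure.isProbabilityMeasure_map hηm.aemeasurable
    have : IsProbabilityMeasure (P.map fun w t => x t w) :=
      Measure.isProbabilityMeasure_map hxm.aemeasurable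
    rw [e, ← Measure.map_apply (hxm.prodMk hηm) hA, hprod, Measure.prod_apply hA]
    calc _ ≤ ∫⁻ _, ENNReal.ofReal B ∂(P.map fun w t => x t w) := lintegral_mono key
      _ = ENNReal.ofReal B := by simp
  exact ENNReal.toReal_le_of_le_ofReal hB0 hfin

end

/-! ### Partitions and models -/

section

variable {d : ℕ}

theorem finrank_partitionSubspace_le (r : Setoid (Fin d)) :
    Module.finrank ℝ (partitionSubspace r) ≤ numClasses r := by
  classical
  let f : (Quotient r → ℝ) →ₗ[ℝ] Vec d :=
    { toFun := fun g => WithLp.toLp 2 fun i => g (Quotient.mk r i)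
      map_add' := fun a b => by ext i; simp
      map_smul' := fun c a => by ext i; simp }
  have hle : partitionSubspace r ≤ LinearMap.range f := by
    intro x hx
    refine ⟨fun q => Quotient.lift (fun i => x i) (fun i j h => hx i j h) q, ?_⟩
    ext i
    simp [f]
  calc Module.finrank ℝ (partitionSubspace r) ≤ Module.finrank ℝ (LinearMap.range f) :=
        Submodule.finrank_mono hle
    _ ≤ Module.finrank ℝ (Quotient r → ℝ) := LinearMap.finrank_range_le f
    _ = numClasses r := by rw [Module.finrank_fintype_fun_eq_card, numClasses,
        Nat.card_eq_fintype_card]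

theorem finrank_partitionSubspace_sup_le {r r' : Setoid (Fin d)} {d₀ : ℕ}
    (hr : numClasses r ≤ d₀) (hr' : numClasses r' ≤ d₀) :
    Module.finrank ℝ (partitionSubspace r ⊔ partitionSubspace r' : Submodule ℝ (Vec d)) ≤
      2 * d₀ := by
  have h := Submodule.finrank_add_le_finrank_add_finrank (partitionSubspace r)
    (partitionSubspace r')
  have h1 := finrank_partitionSubspace_le r
  have h2 := finrank_partitionSubspace_le r'
  omega

theorem numClasses_pos (hd : 0 < d) (r : Setoid (Fin d)) : 1 ≤ numClasses r := by
  have : Nonempty (Quotient r) := ⟨Quotient.mk r ⟨0, hd⟩⟩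
  exact Nat.card_pos

theorem finite_setoid_set (Q : Set (Setoid (Fin d))) : Q.Finite := by
  have : Finite (Setoid (Fin d)) :=
    Finite.of_injective (fun r : Setoid (Fin d) => (r : Fin d → Fin d → Prop))
      fun r r' h => Setoid.ext fun i j => by
        have := congrFun (congrFun h i) j
        exact this.to_iff
  exact Q.toFinite

/-- Each class count contributes at most `A d ^ (c d₀)`. The number `d₀` of class counts is absorbed
by `d₀ ≤ 2 ^ d₀ ≤ exp (d₀ l)`, whence `c + 1`. -/
theorem ncard_partitions_le (hd : 0 < d) {A c : ℝ} (hA : 0 < A) (hc : 0 < c) {d₀ : ℕ}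
    {Q : Set (Setoid (Fin d))} (hQ : ∀ r ∈ Q, numClasses r ≤ d₀)
    (hcard : ∀ k : ℕ, 1 ≤ k → k ≤ d₀ →
      (({r ∈ Q | numClasses r = k}.ncard : ℕ) : ℝ) ≤ A * (d : ℝ) ^ (c * (k : ℝ)))
    {l : ℝ} (hl : Real.log 2 ≤ l) (hdl : Real.log d ≤ l) :
    (Q.ncard : ℝ) ≤ A * Real.exp ((c + 1) * (d₀ * l)) := by
  classical
  have hd1 : (1 : ℝ) ≤ d := by exact_mod_cast hd
  have hsub : Q ⊆ ⋃ k ∈ Finset.Icc 1 d₀, {r ∈ Q | numClasses r = k} := by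
    intro r hr
    simp only [Set.mem_iUnion]
    exact ⟨numClasses r, Finset.mem_Icc.mpr ⟨numClasses_pos hd r, hQ r hr⟩, hr, rfl⟩
  have h1 : Q.ncard ≤ ∑ k ∈ Finset.Icc 1 d₀, {r ∈ Q | numClasses r = k}.ncard :=
    (Set.ncard_le_ncard hsub (finite_setoid_set _)).trans
      (Finset.set_ncard_biUnion_le _ _)
  have hpow : (d : ℝ) ^ (c * (d₀ : ℝ)) ≤ Real.exp (c * (d₀ * l)) := by
    rw [Real.rpow_def_of_pos (by linarith)]
    refine Real.exp_le_exp.mpr ?_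
    calc Real.log d * (c * d₀) ≤ l * (c * d₀) := by gcongr
      _ = _ := by ring
  have htwo : (d₀ : ℝ) ≤ Real.exp (d₀ * l) := by
    calc (d₀ : ℝ) ≤ (2 : ℝ) ^ d₀ := by exact_mod_cast Nat.lt_two_pow_self.le
      _ = Real.exp (d₀ * Real.log 2) := by
        rw [Real.exp_nat_mul, Real.exp_log (by norm_num)]
      _ ≤ _ := by gcongr
  calc (Q.ncard : ℝ) ≤ ∑ k ∈ Finset.Icc 1 d₀, (({r ∈ Q | numClasses r = k}.ncard : ℕ) : ℝ) := by
        exact_mod_cast h1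
    _ ≤ ∑ k ∈ Finset.Icc 1 d₀, A * (d : ℝ) ^ (c * (d₀ : ℝ)) := by
        refine Finset.sum_le_sum fun k hk => ?_
        obtain ⟨hk1, hk2⟩ := Finset.mem_Icc.mp hk
        refine (hcard k hk1 hk2).trans ?_
        gcongr
    _ = d₀ * (A * (d : ℝ) ^ (c * (d₀ : ℝ))) := by simp
    _ ≤ Real.exp (d₀ * l) * (A * Real.exp (c * (d₀ * l))) := by gcongr
    _ = A * Real.exp ((c + 1) * (d₀ * l)) := by
        rw [add_mul, Real.exp_add, one_mul]
        ring

/-- Pairing with `v ∈ m` only sees the projection of `z` on `m`, so no bound on `‖z‖` itself is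
needed. -/
theorem abs_inner_le_of_mem {m : Submodule ℝ (Vec d)} {z v : Vec d} {K : ℝ}
    (hz : ‖m.starProjection z‖ ^ 2 ≤ K) (hv : v ∈ m) : |inner ℝ z v| ≤ √K * ‖v‖ := by
  have e : inner ℝ z v = inner ℝ (m.starProjection z) v := by
    rw [Submodule.inner_starProjection_left_eq_right,
      Submodule.starProjection_eq_self_iff.mpr hv]
  rw [e]
  refine (abs_real_inner_le_norm _ _).trans ?_
  gcongr
  exact Real.le_sqrt_of_sq_le hz

end

/-! ### The second moment as a Hilbert space norm -/

section

variable {d : ℕ} {ν : Measure (Vec d)}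

/-- The map `v ↦ ⟨·, v⟩` from `ℝ^d` to `L²(ν)`. -/
noncomputable def innerLp (h : MemLp (fun x : Vec d => x) 2 ν) : Vec d →ₗ[ℝ] Lp ℝ 2 ν where
  toFun v := (h.inner_const v (𝕜 := ℝ)).toLp _
  map_add' a b := by
    rw [← MemLp.toLp_add]
    congr 1
    ext x
    simp [inner_add_right]
  map_smul' c a := by
    rw [RingHom.id_apply, ← MemLp.toLp_const_smul]
    congr 1
    ext x
    simp [inner_smul_right]

theorem inner_innerLp (h : MemLp (fun x : Vec d => x) 2 ν) (u v : Vec d) :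
    inner ℝ (innerLp h u) (innerLp h v) = ∫ x, inner ℝ x u * inner ℝ x v ∂ν := by
  rw [L2.inner_def]
  refine integral_congr_ae ?_
  filter_upwards [(h.inner_const u (𝕜 := ℝ)).coeFn_toLp, (h.inner_const v (𝕜 := ℝ)).coeFn_toLp]
    with x h1 h2
  change inner ℝ ((h.inner_const u (𝕜 := ℝ)).toLp _ x) ((h.inner_const v (𝕜 := ℝ)).toLp _ x) = _
  rw [h1, h2, RCLike.inner_apply, conj_trivial, mul_comm]

theorem integrable_inner_mul_inner (h : MemLp (fun x : Vec d => x) 2 ν) (u v : Vec d) :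
    Integrable (fun x => inner ℝ x u * inner ℝ x v : Vec d → ℝ) ν :=
  (h.inner_const u).integrable_mul (h.inner_const v)

theorem integrable_coord_mul (h : MemLp (fun x : Vec d => x) 2 ν) (i j : Fin d) :
    Integrable (fun x : Vec d => x i * x j) ν := by
  have := integrable_inner_mul_inner h (EuclideanSpace.single i 1) (EuclideanSpace.single j 1)
  simpa [EuclideanSpace.inner_single_right] using this

open Matrix in
theorem dotProduct_secondMoment_mulVec (h : MemLp (fun x : Vec d => x) 2 ν) (v : Vec d) :
    (v : Fin d → ℝ) ⬝ᵥ (secondMoment ν *ᵥ v) = ‖innerLp h v‖ ^ 2 := by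
  rw [← real_inner_self_eq_norm_sq, inner_innerLp]
  have e : ∀ x : Vec d, inner ℝ x v * inner ℝ x v = ∑ i, ∑ j, v i * (x i * x j * v j) := by
    intro x
    simp only [PiLp.inner_apply, RCLike.inner_apply, conj_trivial, Finset.sum_mul_sum]
    refine Finset.sum_congr rfl fun i _ => Finset.sum_congr rfl fun j _ => ?_
    ring
  simp only [e]
  rw [integral_finsetSum _ fun i _ => integrable_finsetSum _ fun j _ =>
    ((integrable_coord_mul h i j).mul_const _).const_mul _]
  simp only [dotProduct, mulVec, secondMoment, Matrix.of_apply, Finset.mul_sum]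
  refine Finset.sum_congr rfl fun i _ => ?_
  rw [integral_finsetSum _ fun j _ => ((integrable_coord_mul h i j).mul_const _).const_mul _]
  refine Finset.sum_congr rfl fun j _ => ?_
  rw [integral_const_mul, integral_mul_const]

/-- Subtracting `lambdaMin A` times the identity shifts the spectrum into `[0, ∞)`, leaving a
positive semidefinite matrix. -/
theorem lambdaMin_mul_dotProduct_le {A : Matrix (Fin d) (Fin d) ℝ} (hA : A.IsHermitian)
    (v : Fin d → ℝ) : lambdaMin A * dotProduct v v ≤ dotProduct v (A.mulVec v) := by
  have hscalar : (algebraMap ℝ (Matrix (Fin d) (Fin d) ℝ) (lambdaMin A)).IsHermitian := by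
    rw [Matrix.IsHermitian, Matrix.algebraMap_eq_diagonal, Matrix.diagonal_conjTranspose]
    congr 1
  have hpsd : (-algebraMap ℝ (Matrix (Fin d) (Fin d) ℝ) (lambdaMin A) + A).PosSemidef := by
    rw [Matrix.posSemidef_iff_isHermitian_and_spectrum_nonneg]
    refine ⟨hscalar.neg.add hA, fun a ha => ?_⟩
    have ha' : a + lambdaMin A ∈ spectrum ℝ A := spectrum.add_mem_iff.mpr ha
    have hbdd : BddBelow (spectrum ℝ A) := by
      rw [hA.spectrum_real_eq_range_eigenvalues]
      exact (Set.finite_range _).bddBelow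
    have : lambdaMin A ≤ a + lambdaMin A := csInf_le hbdd ha'
    change 0 ≤ a
    linarith
  have h := hpsd.dotProduct_mulVec_nonneg v
  rw [Algebra.algebraMap_eq_smul_one, Matrix.add_mulVec, Matrix.neg_mulVec, Matrix.smul_mulVec,
    Matrix.one_mulVec, dotProduct_add, dotProduct_neg, dotProduct_smul, smul_eq_mul,
    star_trivial] at h
  linarith

theorem lambdaMin_mul_norm_sq_le (h : MemLp (fun x : Vec d => x) 2 ν) (v : Vec d) :
    lambdaMin (secondMoment ν) * ‖v‖ ^ 2 ≤ ‖innerLp h v‖ ^ 2 := by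
  have hA : (secondMoment ν).IsHermitian := by
    ext i j
    simp [secondMoment, mul_comm]
  have := lambdaMin_mul_dotProduct_le hA v
  rw [dotProduct_secondMoment_mulVec h] at this
  rw [EuclideanSpace.real_norm_sq_eq]
  simpa [dotProduct, sq] using this

end

/-! ### Least squares over a selected model -/

section

variable {d n : ℕ}

/-- Thus `colSpace m x` is the image of `m` under the design map, and the selection criterion is the
least-squares residual over `m`. -/
theorem design_starProjection (m : Submodule ℝ (Vec d)) (x : Fin n → Vec d) (v : Vec d) :
    design (fun t => m.starProjection (x t)) v = design x (m.starProjection v) := by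
  ext t
  exact Submodule.inner_starProjection_left_eq_right m (x t) v

theorem norm_sub_design_le_of_isSelectedModel {M : Set (Submodule ℝ (Vec d))}
    {x : Fin n → Vec d} {Y : Vec n} {mhat m : Submodule ℝ (Vec d)} {θhat θ : Vec d}
    (hsel : IsSelectedModel M x Y mhat) (hls : IsLeastSquares mhat x Y θhat) (hm : m ∈ M)
    (hθ : θ ∈ m) : ‖Y - design x θhat‖ ^ 2 ≤ ‖Y - design x θ‖ ^ 2 := by
  obtain ⟨u, hu⟩ : fitted mhat x Y ∈ colSpace mhat x := Submodule.starProjection_apply_mem _ _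
  rw [design_starProjection] at hu
  have hmin : ‖Y - fitted m x Y‖ ≤ ‖Y - design x θ‖ := by
    have hmem : design x θ ∈ colSpace m x :=
      ⟨θ, by rw [design_starProjection, Submodule.starProjection_eq_self_iff.mpr hθ]⟩
    rw [fitted, Submodule.starProjection_minimal]
    exact ciInf_le ⟨0, by rintro _ ⟨y, rfl⟩; exact norm_nonneg _⟩
      (⟨design x θ, hmem⟩ : colSpace m x)
  calc ‖Y - design x θhat‖ ^ 2 ≤ ‖Y - design x (mhat.starProjection u)‖ ^ 2 :=
        hls.2 _ (Submodule.starProjection_apply_mem _ _)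
    _ = ‖Y - fitted mhat x Y‖ ^ 2 := by rw [hu]
    _ ≤ ‖Y - fitted m x Y‖ ^ 2 := hsel.2 m hm
    _ ≤ ‖Y - design x θ‖ ^ 2 := by gcongr

/-- Expanding both residuals around `θ`, the terms `ε t ^ 2` cancel. -/
theorem sum_inner_sq_le_of_isSelectedModel {M : Set (Submodule ℝ (Vec d))}
    {x : Fin n → Vec d} {ε : Fin n → ℝ} {mhat m : Submodule ℝ (Vec d)} {θhat θ : Vec d}
    (hsel : IsSelectedModel M x (WithLp.toLp 2 fun t => inner ℝ (x t) θ + ε t) mhat)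
    (hls : IsLeastSquares mhat x (WithLp.toLp 2 fun t => inner ℝ (x t) θ + ε t) θhat)
    (hm : m ∈ M) (hθ : θ ∈ m) :
    ∑ t, inner ℝ (x t) (θhat - θ) ^ 2 ≤ 2 * ∑ t, ε t * inner ℝ (x t) (θhat - θ) := by
  have h := norm_sub_design_le_of_isSelectedModel hsel hls hm hθ
  simp only [EuclideanSpace.real_norm_sq_eq, design, PiLp.sub_apply, LinearMap.coe_mk,
    AddHom.coe_mk] at h
  have e1 : ∀ t, (inner ℝ (x t) θ + ε t - inner ℝ (x t) θhat) ^ 2 =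
      inner ℝ (x t) (θhat - θ) ^ 2 - 2 * (ε t * inner ℝ (x t) (θhat - θ)) + ε t ^ 2 := by
    intro t
    rw [inner_sub_right]
    ring
  have e2 : ∀ t, (inner ℝ (x t) θ + ε t - inner ℝ (x t) θ) ^ 2 = ε t ^ 2 := by
    intro t
    ring
  simp only [e1, e2, Finset.sum_add_distrib, Finset.sum_sub_distrib, ← Finset.mul_sum] at h
  linarith

/-- Estimation error when the empirical second moments and the noise are controlled on a
half-net. -/
theorem IsHalfNet.norm_le_of_sum_inner_sq_le {F : Type*} [NormedAddCommGroup F]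
    [InnerProductSpace ℝ F] {L : Vec d →ₗ[ℝ] F} {S : Submodule ℝ (Vec d)} {N : Finset (Vec d)}
    (hN : IsHalfNet L S N) {κ : ℝ} (hκ : 0 < κ) (hL : ∀ v, κ * ‖v‖ ≤ ‖L v‖) (hn : 0 < n)
    {x : Fin n → Vec d} {ε : Fin n → ℝ} {s : ℝ} (hs : 0 ≤ s)
    (hcov : ∀ w ∈ N, ∀ w' ∈ N,
      |∑ t, inner ℝ (x t) w * inner ℝ (x t) w' - n * inner ℝ (L w) (L w')| ≤ n * (1 / 8))
    (hnoise : ∀ w ∈ N, ∑ t, inner ℝ (x t) w ^ 2 ≤ 3 / 2 * n →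
      |∑ t, ε t * inner ℝ (x t) w| ≤ s)
    {v : Vec d} (hv : v ∈ S)
    (hX : ∑ t, inner ℝ (x t) v ^ 2 ≤ 2 * ∑ t, ε t * inner ℝ (x t) v) :
    ‖L v‖ ≤ 8 * s / n := by
  have hn' : (0 : ℝ) < n := by exact_mod_cast hn
  let B : Vec d →ₗ[ℝ] Vec d →ₗ[ℝ] ℝ := LinearMap.mk₂ ℝ
    (fun u v => ∑ t, inner ℝ (x t) u * inner ℝ (x t) v - n * inner ℝ (L u) (L v))
    (fun a b c => by
      simp only [map_add, inner_add_right, inner_add_left, add_mul, Finset.sum_add_distrib]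
      ring)
    (fun r a b => by
      simp only [map_smul, inner_smul_right, real_inner_smul_left, mul_assoc, ← Finset.mul_sum,
        smul_eq_mul]
      ring)
    (fun a b c => by
      simp only [map_add, inner_add_right, mul_add, Finset.sum_add_distrib]
      ring)
    (fun r a b => by
      simp only [map_smul, inner_smul_right, mul_left_comm _ r, ← Finset.mul_sum,
        smul_eq_mul]
      ring)
  -- The error `n/8` on net pairs becomes `n/2` on all of `S`, so half of `n ‖L v‖²` survives.
  have hBv := hN.abs_bilin_le hκ hL B (by positivity) hcov hv
  have e : B v v = ∑ t, inner ℝ (x t) v ^ 2 - n * ‖L v‖ ^ 2 := by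
    simp only [B, LinearMap.mk₂_apply, real_inner_self_eq_norm_sq, sq]
  rw [e] at hBv
  let f : Vec d →ₗ[ℝ] ℝ := ∑ t, ε t • (innerₗ (Vec d) (x t))
  have hf : ∀ u, f u = ∑ t, ε t * inner ℝ (x t) u := by
    intro u
    simp [f]
  have hfw : ∀ w ∈ N, |f w| ≤ s := by
    intro w hw
    rw [hf]
    refine hnoise w hw ?_
    have h1 := (abs_le.mp (hcov w hw w hw)).2
    rw [real_inner_self_eq_norm_sq] at h1
    have h2 : ‖L w‖ ^ 2 ≤ 1 := pow_le_one₀ (norm_nonneg _) (hN.norm_le w hw)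
    simp only [sq] at h1 h2 ⊢
    nlinarith
  have hfv := (le_abs_self _).trans (hN.abs_apply_le hκ hL f hs hfw hv)
  rw [hf] at hfv
  have h1 := (abs_le.mp hBv).1
  have h2 : n / 2 * ‖L v‖ ^ 2 ≤ 4 * s * ‖L v‖ := by linarith
  rw [le_div_iff₀ hn']
  rcases eq_or_lt_of_le (norm_nonneg (L v)) with h0 | hpos
  · rw [← h0]
    linarith
  · nlinarith

end

section

variable {d n T : ℕ} {Ω : Type*} [MeasurableSpace Ω] {P : Measure Ω} {X : Set (Vec d)}
  {ν : Measure (Vec d)} {θ xstar : Vec d} {σ : ℝ} {x : ℕ → Ω → Vec d} {η : ℕ → Ω → ℝ}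
  {mhat : Ω → Submodule ℝ (Vec d)} {θhat : Ω → Vec d}

/-! ### The estimation error -/

theorem IsEMCRun.measureReal_noise_le [IsProbabilityMeasure P] {M : Set (Submodule ℝ (Vec d))}
    (run : IsEMCRun P X M ν θ σ T n x η mhat θhat) (hnT : n ≤ T) (hσ : 0 < σ) (v : Vec d)
    {s V : ℝ} (hs : 0 ≤ s) :
    P.real {w | ∑ t : Fin n, inner ℝ (x t w) v ^ 2 ≤ V ∧
      s ≤ |∑ t : Fin n, η t w * inner ℝ (x t w) v|} ≤
      2 * Real.exp (-s ^ 2 / (2 * (V * σ ^ 2))) := by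
  have hσ2 : 0 < Real.toNNReal (σ ^ 2) := Real.toNNReal_pos.mpr (by positivity)
  have hind : iIndepFun (fun t : Fin n => η t) P :=
    run.noise_indep.precomp (Fin.castLE_injective hnT)
  have hxη : IndepFun (fun w (t : Fin n) => x t w) (fun w (t : Fin n) => η t w) P :=
    run.explore_indep_noise.comp measurable_id
      (measurable_pi_lambda _ fun t : Fin n => measurable_pi_apply (Fin.castLE hnT t))
  have h := measureReal_abs_sum_mul_ge_le (x := fun t : Fin n => x t)
    (η := fun t : Fin n => η t) (fun t => run.measurable_arm t (t.2.trans_le hnT))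
    (fun t => run.measurable_noise t (t.2.trans_le hnT))
    (fun t => run.noise_law t (t.2.trans_le hnT)) hind hxη
    (g := fun z => inner ℝ z v) (by fun_prop) (V := V) hs hσ2
  rwa [Real.coe_toNNReal _ (sq_nonneg σ)] at h

/-- Outside an event of small probability, the estimation error is small in the direction of all
arms. -/
theorem IsEMCRun.exists_event_abs_inner_sub_le [IsProbabilityMeasure P] {d₀ : ℕ}
    {Q : Set (Setoid (Fin d))} (run : IsEMCRun P X (models Q) ν θ σ T n x η mhat θhat)
    (hnT : n ≤ T) (hn : 0 < n) (hσ : 0 < σ) (hQ : ∀ r ∈ Q, numClasses r ≤ d₀)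
    {r₀ : Setoid (Fin d)} (hr₀ : r₀ ∈ Q) (hθ : θ ∈ partitionSubspace r₀)
    (hν : IsArmDistribution X ν) {K C : ℝ} (hK : 0 < K) (hC : 0 < C)
    (hKX : ∀ z ∈ X, ∀ m ∈ extendedModels (models Q), ‖m.starProjection z‖ ^ 2 ≤ K)
    (hCν : C = lambdaMin (secondMoment ν)) {s : ℝ} (hs : 0 ≤ s) :
    ∃ B : Set Ω,
      P.real B ≤ Q.ncard * ((25 : ℝ) ^ (2 * d₀) *
          (2 * Real.exp (-(n * ((1 / 8) ^ 2 / (2 * (K / C) ^ 2))))) +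
        (5 : ℝ) ^ (2 * d₀) * (2 * Real.exp (-s ^ 2 / (2 * (3 / 2 * n * σ ^ 2))))) ∧
      ∀ᵐ w ∂P, w ∉ B → ∀ z ∈ X, |inner ℝ z (θhat w - θ)| ≤ √K * (8 * s / n / √C) := by
  classical
  have hLp := hν.memLp_two
  set L := innerLp hLp with hLdef
  have hL : ∀ v, √C * ‖v‖ ≤ ‖L v‖ := by
    intro v
    refine abs_le_of_sq_le_sq' ?_ (norm_nonneg _) |>.2
    rw [mul_pow, Real.sq_sqrt hC.le, hCν]
    exact lambdaMin_mul_norm_sq_le hLp v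
  have hκ : 0 < √C := Real.sqrt_pos.mpr hC
  -- If `r` is the selected partition, the error `θhat - θ` lies in `S r`.
  let S : Setoid (Fin d) → Submodule ℝ (Vec d) := fun r =>
    partitionSubspace r₀ ⊔ partitionSubspace r
  have hSext : ∀ r ∈ Q, S r ∈ extendedModels (models Q) := fun r hr =>
    ⟨_, ⟨r₀, hr₀, rfl⟩, _, ⟨r, hr, rfl⟩, rfl⟩
  have hnet : ∀ r, ∃ N : Finset (Vec d),
      N.card ≤ 5 ^ Module.finrank ℝ (S r) ∧ IsHalfNet L (S r) N := fun r =>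
    exists_isHalfNet L (S r)
  choose N hNcard hN using hnet
  have hNcard' : ∀ r ∈ Q, ((N r).card : ℝ) ≤ 5 ^ (2 * d₀) := by
    intro r hr
    have h := (hNcard r).trans (Nat.pow_le_pow_right (by norm_num)
      (finrank_partitionSubspace_sup_le (hQ r₀ hr₀) (hQ r hr)))
    exact_mod_cast h
  let Bcov : Vec d → Vec d → Set Ω := fun v v' => {w | n * (1 / 8) ≤
    |∑ t : Fin n, inner ℝ (x t w) v * inner ℝ (x t w) v' -
      n * ∫ z, inner ℝ z v * inner ℝ z v' ∂ν|}
  let Bnoise : Vec d → Set Ω := fun v => {w | ∑ t : Fin n, inner ℝ (x t w) v ^ 2 ≤ 3 / 2 * n ∧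
      s ≤ |∑ t : Fin n, η t w * inner ℝ (x t w) v|}
  set a := 2 * Real.exp (-(n * ((1 / 8) ^ 2 / (2 * (K / C) ^ 2)))) with ha
  set b := 2 * Real.exp (-s ^ 2 / (2 * (3 / 2 * n * σ ^ 2))) with hb
  have ha0 : 0 ≤ a := by positivity
  have hb0 : 0 ≤ b := by positivity
  have hKabs : ∀ r ∈ Q, ∀ v ∈ S r, ∀ z ∈ X, |inner ℝ z v| ≤ √K * ‖v‖ := fun r hr v hv z hz =>
    abs_inner_le_of_mem (hKX z hz _ (hSext r hr)) hv
  have hcov : ∀ r ∈ Q, ∀ v ∈ N r, ∀ v' ∈ N r, P.real (Bcov v v') ≤ a := by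
    intro r hr v hv v' hv'
    refine measureReal_abs_sum_sub_integral_ge_le (x := fun t : Fin n => x t)
      (g := fun z => inner ℝ z v * inner ℝ z v')
      (fun t => run.measurable_arm t (t.2.trans_le hnT)) (fun t => run.explore_law t t.2)
      run.explore_indep (by fun_prop) (by positivity) ?_ (by norm_num)
    filter_upwards [hν.supported] with z hz
    -- Net points satisfy `√C ‖u‖ ≤ ‖L u‖ ≤ 1`; products of two such forms are thus bounded by `K /
    -- C`.
    have hv1 : ∀ u ∈ N r, |inner ℝ z u| ≤ √K / √C := by
      intro u hu
      refine (hKabs r hr u ((hN r).mem u hu) z hz).trans ?_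
      rw [div_eq_mul_inv]
      gcongr
      rw [← one_div, le_div_iff₀ hκ, mul_comm]
      exact (hL u).trans ((hN r).norm_le u hu)
    calc |inner ℝ z v * inner ℝ z v'| = |inner ℝ z v| * |inner ℝ z v'| := abs_mul _ _
      _ ≤ (√K / √C) * (√K / √C) := by gcongr <;> exact hv1 _ ‹_›
      _ = K / C := by
        rw [div_mul_div_comm, Real.mul_self_sqrt hK.le, Real.mul_self_sqrt hC.le]
  have hnoise : ∀ v, P.real (Bnoise v) ≤ b := fun v => run.measureReal_noise_le hnT hσ v hs
  let Qf : Finset (Setoid (Fin d)) := (finite_setoid_set Q).toFinset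
  have hQf : ∀ r, r ∈ Qf ↔ r ∈ Q := fun r => Set.Finite.mem_toFinset _
  -- Since the selected model depends on the data, the bad event collects the failures of all
  -- candidates.
  let B : Set Ω := ⋃ r ∈ Qf, (⋃ v ∈ N r, ⋃ v' ∈ N r, Bcov v v') ∪ ⋃ v ∈ N r, Bnoise v
  refine ⟨B, ?_, ?_⟩
  · have hr : ∀ r ∈ Qf, P.real ((⋃ v ∈ N r, ⋃ v' ∈ N r, Bcov v v') ∪ ⋃ v ∈ N r, Bnoise v) ≤
        (25 : ℝ) ^ (2 * d₀) * a + (5 : ℝ) ^ (2 * d₀) * b := by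
      intro r hr
      have hr := (hQf r).mp hr
      have hc := hNcard' r hr
      refine (measureReal_union_le _ _).trans (add_le_add ?_ ?_)
      · calc P.real (⋃ v ∈ N r, ⋃ v' ∈ N r, Bcov v v')
            ≤ ∑ v ∈ N r, ∑ v' ∈ N r, P.real (Bcov v v') :=
              (measureReal_biUnion_finset_le _ _).trans
                (Finset.sum_le_sum fun v _ => measureReal_biUnion_finset_le _ _)
          _ ≤ ∑ v ∈ N r, ∑ v' ∈ N r, a :=
              Finset.sum_le_sum fun v hv => Finset.sum_le_sum fun v' hv' => hcov r hr v hv v' hv'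
          _ = (N r).card * ((N r).card * a) := by simp
          _ ≤ 5 ^ (2 * d₀) * (5 ^ (2 * d₀) * a) := by gcongr
          _ = _ := by
              rw [← mul_assoc, ← mul_pow]
              norm_num
      · calc P.real (⋃ v ∈ N r, Bnoise v) ≤ ∑ v ∈ N r, P.real (Bnoise v) :=
              measureReal_biUnion_finset_le _ _
          _ ≤ ∑ v ∈ N r, b := Finset.sum_le_sum fun v _ => hnoise v
          _ = (N r).card * b := by simp
          _ ≤ _ := by gcongr
    calc P.real B ≤ ∑ r ∈ Qf, P.real
          ((⋃ v ∈ N r, ⋃ v' ∈ N r, Bcov v v') ∪ ⋃ v ∈ N r, Bnoise v) :=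
          measureReal_biUnion_finset_le _ _
      _ ≤ ∑ r ∈ Qf, ((25 : ℝ) ^ (2 * d₀) * a + (5 : ℝ) ^ (2 * d₀) * b) := Finset.sum_le_sum hr
      _ = _ := by
        rw [Finset.sum_const, nsmul_eq_mul, Set.ncard_eq_toFinset_card Q (finite_setoid_set Q)]
  · filter_upwards [run.selected, run.estimate] with w hsel hls hwB z hz
    obtain ⟨r, hr, hmr⟩ := hsel.1
    have hθhat : θhat w ∈ partitionSubspace r := hmr ▸ hls.1
    have hmem : θhat w - θ ∈ S r :=
      (S r).sub_mem (Submodule.mem_sup_right hθhat) (Submodule.mem_sup_left hθ)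
    have hout : w ∉ (⋃ v ∈ N r, ⋃ v' ∈ N r, Bcov v v') ∪ ⋃ v ∈ N r, Bnoise v := fun h =>
      hwB (Set.mem_biUnion ((hQf r).mpr hr) h)
    have hX := sum_inner_sq_le_of_isSelectedModel hsel hls ⟨r₀, hr₀, rfl⟩ hθ
    have hLv : ‖L (θhat w - θ)‖ ≤ 8 * s / n := by
      refine (hN r).norm_le_of_sum_inner_sq_le hκ hL hn hs ?_ ?_ hmem hX
      · intro v hv v' hv'
        rw [hLdef, inner_innerLp]
        by_contra! h
        exact hout (Or.inl (Set.mem_biUnion hv (Set.mem_biUnion hv' h.le)))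
      · intro v hv hle
        by_contra! h
        exact hout (Or.inr (Set.mem_biUnion hv ⟨hle, h.le⟩))
    refine (hKabs r hr _ hmem z hz).trans ?_
    gcongr
    rw [le_div_iff₀ hκ, mul_comm]
    exact (hL _).trans hLv

/-! ### The regret -/

theorem IsEMCRun.ae_mem_arms {M : Set (Submodule ℝ (Vec d))}
    (run : IsEMCRun P X M ν θ σ T n x η mhat θhat) (hν : IsArmDistribution X ν) :
    ∀ᵐ w ∂P, ∀ t < T, x t w ∈ X := by
  rw [ae_all_iff]
  intro t
  by_cases ht : t < T
  · rcases lt_or_ge t n with htn | htn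
    · have := ae_of_ae_map (run.measurable_arm t ht).aemeasurable
        ((run.explore_law t htn).symm ▸ hν.supported)
      filter_upwards [this] with w hw _ using hw
    · filter_upwards [run.greedy t htn ht] with w hw _ using hw.1
  · exact Filter.Eventually.of_forall fun w h => absurd h ht

theorem integrable_pseudoRegret [IsProbabilityMeasure P] {R : ℝ}
    (hx : ∀ t < T, Measurable (x t)) (hxX : ∀ᵐ w ∂P, ∀ t < T, x t w ∈ X) (hstar : xstar ∈ X)
    (hR : ∀ z ∈ X, |inner ℝ z θ| ≤ R) : Integrable (pseudoRegret T xstar θ x) P := by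
  refine integrable_finsetSum _ fun t ht => ?_
  have ht := Finset.mem_range.mp ht
  refine Integrable.of_bound (C := 2 * R) ?_ ?_
  · exact ((measurable_const.sub (hx t ht)).inner measurable_const).aestronglyMeasurable
  · filter_upwards [hxX] with w hw
    rw [inner_sub_left]
    refine (norm_sub_le _ _).trans ?_
    have h1 := hR _ hstar
    have h2 := hR _ (hw t ht)
    simp only [Real.norm_eq_abs]
    linarith

theorem integral_pseudoRegret_le_of_abs_inner_le [IsProbabilityMeasure P] {R : ℝ}
    (hx : ∀ t < T, Measurable (x t)) (hxX : ∀ᵐ w ∂P, ∀ t < T, x t w ∈ X) (hstar : xstar ∈ X)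
    (hR : ∀ z ∈ X, |inner ℝ z θ| ≤ R) :
    ∫ w, pseudoRegret T xstar θ x w ∂P ≤ 2 * R * T := by
  have hint := integrable_pseudoRegret hx hxX hstar hR
  calc ∫ w, pseudoRegret T xstar θ x w ∂P ≤ ∫ _, 2 * R * T ∂P := by
        refine integral_mono_ae hint (integrable_const _) ?_
        filter_upwards [hxX] with w hw
        calc pseudoRegret T xstar θ x w ≤ ∑ t ∈ Finset.range T, 2 * R := by
              refine Finset.sum_le_sum fun t ht => ?_
              have h1 := abs_le.mp (hR _ hstar)
              have h2 := abs_le.mp (hR _ (hw t (Finset.mem_range.mp ht)))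
              rw [inner_sub_left]
              linarith
          _ = 2 * R * T := by simp [mul_comm]
    _ = 2 * R * T := by simp

/-- In a greedy round `⟨xstar - x_t, θ⟩ ≤ ⟨xstar - x_t, θ - θhat⟩ ≤ 2ρ`; exploration rounds and the
bad event are charged the trivial `2R` per round. -/
theorem IsEMCRun.integral_pseudoRegret_le [IsProbabilityMeasure P]
    {M : Set (Submodule ℝ (Vec d))} (run : IsEMCRun P X M ν θ σ T n x η mhat θhat)
    (hν : IsArmDistribution X ν) (hstar : xstar ∈ X) {R ρ δ : ℝ} (hR0 : 0 ≤ R)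
    (hR : ∀ z ∈ X, |inner ℝ z θ| ≤ R) (hρ : 0 ≤ ρ) {B : Set Ω} (hB : P.real B ≤ δ)
    (hgood : ∀ᵐ w ∂P, w ∉ B → ∀ z ∈ X, |inner ℝ z (θhat w - θ)| ≤ ρ) :
    ∫ w, pseudoRegret T xstar θ x w ∂P ≤ 2 * R * n + 2 * ρ * T + 2 * R * T * δ := by
  have hxX := run.ae_mem_arms hν
  have hint := integrable_pseudoRegret run.measurable_arm hxX hstar hR
  -- `B` need not be measurable; its measurable hull has the same probability.
  set D := toMeasurable P B
  have hD : MeasurableSet D := measurableSet_toMeasurable P B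
  have hDδ : P.real D ≤ δ := by
    rwa [measureReal_def, measure_toMeasurable]
  have hgreedy : ∀ᵐ w ∂P, ∀ t, n ≤ t → t < T →
      inner ℝ (θhat w) xstar ≤ inner ℝ (θhat w) (x t w) := by
    rw [ae_all_iff]
    intro t
    by_cases ht : n ≤ t ∧ t < T
    · filter_upwards [run.greedy t ht.1 ht.2] with w hw _ _ using hw.2 _ hstar
    · exact Filter.Eventually.of_forall fun w h1 h2 => absurd ⟨h1, h2⟩ ht
  have hind : Integrable (D.indicator fun _ => 2 * R * T) P :=
    (integrable_const _).indicator hD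
  calc ∫ w, pseudoRegret T xstar θ x w ∂P
      ≤ ∫ w, ((2 * R * n + 2 * ρ * T) + D.indicator (fun _ => 2 * R * T) w) ∂P := by
        refine integral_mono_ae hint ((integrable_const _).add hind) ?_
        filter_upwards [hxX, hgood, hgreedy] with w hw hgw hgr
        have htriv : ∀ t < T, inner ℝ (xstar - x t w) θ ≤ 2 * R := by
          intro t ht
          have h1 := abs_le.mp (hR _ hstar)
          have h2 := abs_le.mp (hR _ (hw t ht))
          rw [inner_sub_left]
          linarith
        by_cases hwD : w ∈ D
        · rw [Set.indicator_of_mem hwD]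
          calc pseudoRegret T xstar θ x w ≤ ∑ t ∈ Finset.range T, 2 * R :=
                Finset.sum_le_sum fun t ht => htriv t (Finset.mem_range.mp ht)
            _ = 2 * R * T := by simp [mul_comm]
            _ ≤ _ := le_add_of_nonneg_left (by positivity)
        · rw [Set.indicator_of_notMem hwD, add_zero]
          have hg := hgw fun h => hwD (subset_toMeasurable P B h)
          calc pseudoRegret T xstar θ x w
              ≤ ∑ t ∈ Finset.range T, ((if t < n then 2 * R else 0) + 2 * ρ) := by
                refine Finset.sum_le_sum fun t ht => ?_
                have ht := Finset.mem_range.mp ht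
                split_ifs with htn
                · linarith [htriv t ht]
                · have h1 := abs_le.mp (hg _ hstar)
                  have h2 := abs_le.mp (hg _ (hw t ht))
                  have h3 := hgr t (not_lt.mp htn) ht
                  rw [real_inner_comm, real_inner_comm (x t w)] at h3
                  rw [inner_sub_right] at h1 h2
                  rw [inner_sub_left]
                  linarith
            _ ≤ 2 * R * n + 2 * ρ * T := by
                rw [Finset.sum_add_distrib, ← Finset.sum_filter, Finset.sum_const,
                  Finset.sum_const, Finset.card_range, nsmul_eq_mul, nsmul_eq_mul]
                have hcard : (((Finset.range T).filter fun t => t < n).card : ℝ) ≤ n := by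
                  have : (Finset.range T).filter (fun t => t < n) ⊆ Finset.range n := by
                    intro t ht
                    exact Finset.mem_range.mpr (Finset.mem_filter.mp ht).2
                  have := Finset.card_le_card this
                  rw [Finset.card_range] at this
                  exact_mod_cast this
                nlinarith
    _ = 2 * R * n + 2 * ρ * T + 2 * R * T * P.real D := by
        rw [integral_add (integrable_const _) hind, integral_indicator_const _ hD]
        simp [mul_comm]
    _ ≤ _ := by gcongr

end

/-! ### The exploration length -/

theorem regretRate_eq_mul_explorationLength {R σ C K : ℝ} (hR : 0 < R) (d₀ d T : ℕ) :
    regretRate R σ C K d₀ d T = R * explorationLength R σ C K d₀ d T := by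
  have h : R ^ (1 / 3 : ℝ) = R * R ^ (-(2 / 3) : ℝ) := by
    rw [← Real.rpow_one_add' hR.le (by norm_num)]
    norm_num
  rw [regretRate, explorationLength, h]
  ring

/-- The balance equation between exploration cost `R t₁` and commitment cost `ρ T`, free of
fractional powers. -/
theorem explorationLength_pow_three {R σ C K : ℝ} (hR : 0 < R) (hσ : 0 < σ) (hC : 0 < C)
    (hK : 0 < K) (d₀ d T : ℕ) (hl : 0 ≤ Real.log ((d : ℝ) * T)) :
    explorationLength R σ C K d₀ d T ^ 3 * (R ^ 2 * C) =
      σ ^ 2 * K * d₀ * T ^ 2 * Real.log ((d : ℝ) * T) := by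
  have hcube : ∀ y a : ℝ, 0 ≤ y → (y ^ a) ^ 3 = y ^ (a * 3) := fun y a hy => by
    rw [Real.rpow_mul hy]
    norm_cast
  simp only [explorationLength, mul_pow]
  rw [hcube R _ hR.le, hcube σ _ hσ.le, hcube C _ hC.le, hcube K _ hK.le,
    hcube _ _ (Nat.cast_nonneg d₀), hcube _ _ (Nat.cast_nonneg T), hcube _ _ hl]
  norm_num
  rw [Real.rpow_neg_one]
  field_simp

/-- The all-ones vector lies in every model, so it can be tested against both bounds. The resulting
`Cmin ≤ K` yields `1 ≤ t₁` in the main proof. -/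
theorem lambdaMin_secondMoment_le {d : ℕ} (hd : 0 < d) {Q : Set (Setoid (Fin d))}
    {r₀ : Setoid (Fin d)} (hr₀ : r₀ ∈ Q) {X : Set (Vec d)} {ν : Measure (Vec d)}
    (hν : IsArmDistribution X ν) {K : ℝ}
    (hKX : ∀ z ∈ X, ∀ m ∈ extendedModels (models Q), ‖m.starProjection z‖ ^ 2 ≤ K)
    (hK : 0 < K) : lambdaMin (secondMoment ν) ≤ K := by
  have := hν.isProbabilityMeasure
  let v : Vec d := WithLp.toLp 2 fun _ => 1
  have hv : v ∈ partitionSubspace r₀ ⊔ partitionSubspace r₀ :=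
    Submodule.mem_sup_left fun _ _ _ => rfl
  have hv0 : 0 < ‖v‖ ^ 2 := by
    rw [EuclideanSpace.real_norm_sq_eq]
    simpa [v] using hd
  have h1 := lambdaMin_mul_norm_sq_le hν.memLp_two v
  have h2 : ‖innerLp hν.memLp_two v‖ ^ 2 ≤ K * ‖v‖ ^ 2 := by
    rw [← real_inner_self_eq_norm_sq, inner_innerLp]
    calc ∫ z, inner ℝ z v * inner ℝ z v ∂ν ≤ ∫ _, K * ‖v‖ ^ 2 ∂ν := by
          refine integral_mono_ae (integrable_inner_mul_inner hν.memLp_two v v)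
            (integrable_const _) ?_
          filter_upwards [hν.supported] with z hz
          have h := abs_inner_le_of_mem
            (hKX z hz _ ⟨_, ⟨r₀, hr₀, rfl⟩, _, ⟨r₀, hr₀, rfl⟩, rfl⟩) hv
          calc inner ℝ z v * inner ℝ z v = |inner ℝ z v| ^ 2 := by rw [sq_abs, sq]
            _ ≤ (√K * ‖v‖) ^ 2 := by gcongr
            _ = K * ‖v‖ ^ 2 := by rw [mul_pow, Real.sq_sqrt hK.le]
      _ = K * ‖v‖ ^ 2 := by simp
  exact le_of_mul_le_mul_right (h1.trans h2) hv0

theorem pow_le_exp_of_le_two_pow {q k m : ℕ} (hq : q ≤ 2 ^ k) {l : ℝ} (hl : Real.log 2 ≤ l) :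
    (q : ℝ) ^ m ≤ Real.exp (k * (m * l)) := by
  calc (q : ℝ) ^ m ≤ ((2 : ℝ) ^ k) ^ m := by
        gcongr
        exact_mod_cast hq
    _ = Real.exp (k * (m * Real.log 2)) := by
        rw [Real.exp_nat_mul, Real.exp_nat_mul, Real.exp_log (by norm_num), pow_right_comm]
    _ ≤ _ := by gcongr

end SymBandit

/-! ### Choice of constants and proof of the regret bound -/

theorem theorem1 (A c : ℝ) (hA : 0 < A) (hc : 0 < c) :
    ∃ C₀ : ℝ, 0 < C₀ ∧ ∃ C₁ : ℝ, 0 < C₁ ∧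
      ∀ (d d₀ T : ℕ), 2 ≤ d * T →
      -- hidden subgroup and admissible collection of partitions
      ∀ (G : Subgroup (Equiv.Perm (Fin d))) (Q : Set (Setoid (Fin d))),
        (∀ r ∈ Q, SymBandit.numClasses r ≤ d₀) →
        SymBandit.orbitPartition G ∈ Q →
        (∀ k : ℕ, 1 ≤ k → k ≤ d₀ →
          (({r ∈ Q | SymBandit.numClasses r = k}.ncard : ℕ) : ℝ) ≤
            A * (d : ℝ) ^ (c * (k : ℝ))) →
      -- arm set, parameter, optimal arm, boundedness
      ∀ (X : Set (SymBandit.Vec d)) (θ xstar : SymBandit.Vec d) (K R σ : ℝ),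
        θ ∈ SymBandit.fixedSubspace G →
        xstar ∈ X → (∀ z ∈ X, inner ℝ z θ ≤ inner ℝ xstar θ) →
        0 < K → 0 < R → 0 < σ →
        (∀ z ∈ X, ∀ m ∈ SymBandit.extendedModels (SymBandit.models Q),
          ‖m.starProjection z‖ ^ 2 ≤ K) →
        (∀ z ∈ X, |inner ℝ z θ| ≤ R) →
      -- exploratory distribution
      ∀ (ν : Measure (SymBandit.Vec d)) (Cmin : ℝ), SymBandit.IsExploratory X ν →
        Cmin = SymBandit.lambdaMin (SymBandit.secondMoment ν) → 0 < Cmin →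
      -- exploration length, and sample size needed by the exploration phase
      ∀ (t₁ : ℝ), t₁ = SymBandit.explorationLength R σ Cmin K d₀ d T →
        C₀ * (K ^ 2 * (d₀ : ℝ) * (Cmin ^ 2)⁻¹ * Real.log ((d : ℝ) * (T : ℝ))) ≤ t₁ →
      -- a run of the algorithm
      ∀ (Ω : Type*) [MeasurableSpace Ω] (P : Measure Ω) [IsProbabilityMeasure P]
        (x : ℕ → Ω → SymBandit.Vec d) (η : ℕ → Ω → ℝ)
        (mhat : Ω → Submodule ℝ (SymBandit.Vec d)) (θhat : Ω → SymBandit.Vec d),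
        SymBandit.IsEMCRun P X (SymBandit.models Q) ν θ σ T (min ⌈t₁⌉₊ T) x η mhat θhat →
        Integrable (SymBandit.pseudoRegret T xstar θ x) P ∧
        ∫ w, SymBandit.pseudoRegret T xstar θ x w ∂P ≤
          C₁ * SymBandit.regretRate R σ Cmin K d₀ d T := by
  -- Hoeffding's exponent is `n C² / (128 K²)`. In units of `D = d₀ l`, it must beat `c + 1`
  -- (models) and `10` (net pairs), with `1` to spare: `c + 12`. For the noise, `6` (net points)
  -- replaces `10`: `c + 8`. The terms of `C₁` pay for exploration, commitment and the bad event.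
  refine ⟨128 * (c + 12), by positivity, 4 + √(192 * (c + 8)) * 2 + 8 * A, by positivity, ?_⟩
  intro d d₀ T hdT G Q hQ hGQ hcard X θ xstar K R σ hθ hstar _ hK hR hσ hKX hRX ν C hν hCν hC
    t₁ ht₁ hlarge Ω _ P _ x η mhat θhat run
  have hd : 0 < d := Nat.pos_of_ne_zero (by rintro rfl; simp at hdT)
  have hT : 0 < T := Nat.pos_of_ne_zero (by rintro rfl; simp at hdT)
  have hT0 : (0 : ℝ) < T := by exact_mod_cast hT
  have hd1 : (1 : ℝ) ≤ d := by exact_mod_cast hd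
  have hT1 : (1 : ℝ) ≤ T := by exact_mod_cast hT
  have hνX := hν.isArmDistribution
  have hxX := run.ae_mem_arms hνX
  rw [SymBandit.fixedSubspace_eq_partitionSubspace] at hθ
  refine ⟨SymBandit.integrable_pseudoRegret run.measurable_arm hxX hstar hRX, ?_⟩
  rw [SymBandit.regretRate_eq_mul_explorationLength hR, ← ht₁]
  set l := Real.log ((d : ℝ) * T) with hl
  have hl2 : Real.log 2 ≤ l := Real.log_le_log (by norm_num) (by exact_mod_cast hdT)
  have hlpos : 0 < l := (Real.log_pos (by norm_num)).trans_le hl2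
  have hdl : Real.log d ≤ l :=
    Real.log_le_log (by linarith) (le_mul_of_one_le_right (by linarith) hT1)
  have hTl : Real.log T ≤ l := Real.log_le_log hT0 (le_mul_of_one_le_left hT0.le hd1)
  have hd₀ : (1 : ℝ) ≤ d₀ := by
    exact_mod_cast (SymBandit.numClasses_pos hd _).trans (hQ _ hGQ)
  have hcube := SymBandit.explorationLength_pow_three hR hσ hC hK d₀ d T hlpos.le
  rw [← ht₁, ← hl] at hcube
  have hCK : C ≤ K := hCν ▸ SymBandit.lambdaMin_secondMoment_le hd hGQ hνX hKX hK
  set D := (d₀ : ℝ) * l with hD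
  have hDl : l ≤ D := le_mul_of_one_le_left hlpos.le hd₀
  have hlarge' : 128 * (c + 12) * D ≤ t₁ * (C ^ 2 / K ^ 2) := by
    calc 128 * (c + 12) * D = 128 * (c + 12) * (K ^ 2 * d₀ * (C ^ 2)⁻¹ * l) * (C ^ 2 / K ^ 2) := by
          rw [hD]
          field_simp
      _ ≤ _ := by gcongr
  have ht₁1 : 1 ≤ t₁ := by
    have h1 : (C : ℝ) ^ 2 / K ^ 2 ≤ 1 := by
      rw [div_le_one (by positivity)]
      gcongr
    have h2 : (0.6 : ℝ) ≤ D := by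
      have := Real.log_two_gt_d9
      linarith
    have h3 : 1 ≤ t₁ * (C ^ 2 / K ^ 2) := by nlinarith
    have h4 : 0 ≤ C ^ 2 / K ^ 2 := by positivity
    by_contra! h
    rcases le_or_gt t₁ 0 with h5 | h5 <;> nlinarith
  have ht₁0 : 0 < t₁ := by linarith
  set n := min ⌈t₁⌉₊ T with hn
  have hceil : (⌈t₁⌉₊ : ℝ) ≤ 2 * t₁ := by
    have := Nat.ceil_lt_add_one ht₁0.le
    linarith
  have hn2 : (n : ℝ) ≤ 2 * t₁ := (Nat.cast_le.mpr (min_le_left _ _)).trans hceil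
  -- If exploration fills the horizon, then `T ≤ 2 t₁` and the trivial bound suffices.
  rcases le_or_gt T ⌈t₁⌉₊ with hTn | hTn
  · have h := SymBandit.integral_pseudoRegret_le_of_abs_inner_le run.measurable_arm hxX hstar hRX
    have hT2 : (T : ℝ) ≤ 2 * t₁ := (Nat.cast_le.mpr hTn).trans hceil
    calc _ ≤ 2 * R * T := h
      _ ≤ 2 * R * (2 * t₁) := by gcongr
      _ = 4 * (R * t₁) := by ring
      _ ≤ _ := by
        gcongr
        have := Real.sqrt_nonneg (192 * (c + 8))
        linarith
  · have hnt : t₁ ≤ n := by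
      rw [hn, min_eq_left hTn.le]
      exact Nat.le_ceil t₁
    have hn0 : (0 : ℝ) < n := ht₁0.trans_le hnt
    -- Chosen so that the Gaussian exponent `s² / (3 n σ²)` equals `(c + 8) D`.
    set s := √(3 * n * σ ^ 2 * (c + 8) * D) with hs
    have hs2 : s ^ 2 = 3 * n * σ ^ 2 * (c + 8) * D := Real.sq_sqrt (by positivity)
    obtain ⟨B, hB, hgood⟩ := run.exists_event_abs_inner_sub_le (min_le_right _ _)
      (by exact_mod_cast hn0) hσ hQ hGQ hθ hνX hK hC hKX hCν (Real.sqrt_nonneg _ : 0 ≤ s)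
    have hBT : P.real B ≤ 4 * A / T := by
      have hQcard := SymBandit.ncard_partitions_le hd hA hc hQ hcard hl2 hdl
      have e1 : (25 : ℝ) ^ (2 * d₀) ≤ Real.exp (10 * D) := by
        have h := SymBandit.pow_le_exp_of_le_two_pow (q := 25) (k := 5) (m := 2 * d₀)
          (by norm_num) hl2
        push_cast at h
        refine h.trans (le_of_eq ?_)
        rw [hD]
        ring_nf
      have e2 : (5 : ℝ) ^ (2 * d₀) ≤ Real.exp (6 * D) := by
        have h := SymBandit.pow_le_exp_of_le_two_pow (q := 5) (k := 3) (m := 2 * d₀)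
          (by norm_num) hl2
        push_cast at h
        refine h.trans (le_of_eq ?_)
        rw [hD]
        ring_nf
      have e3 : Real.exp (-(n * ((1 / 8) ^ 2 / (2 * (K / C) ^ 2)))) ≤
          Real.exp (-((c + 12) * D)) := by
        refine Real.exp_le_exp.mpr (neg_le_neg ?_)
        calc (c + 12) * D = 128 * (c + 12) * D / 128 := by ring
          _ ≤ t₁ * (C ^ 2 / K ^ 2) / 128 := by gcongr
          _ ≤ n * (C ^ 2 / K ^ 2) / 128 := by gcongr
          _ = _ := by
            field_simp
            norm_num
      have e4 : Real.exp (-s ^ 2 / (2 * (3 / 2 * n * σ ^ 2))) = Real.exp (-((c + 8) * D)) := by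
        congr 1
        rw [hs2]
        field_simp
      calc P.real B ≤ _ := hB
        _ ≤ A * Real.exp ((c + 1) * D) * (Real.exp (10 * D) * (2 * Real.exp (-((c + 12) * D))) +
            Real.exp (6 * D) * (2 * Real.exp (-((c + 8) * D)))) := by
          rw [e4]
          gcongr
        _ = 4 * A * Real.exp (-D) := by
          have h1 : Real.exp ((c + 1) * D) * (Real.exp (10 * D) * Real.exp (-((c + 12) * D))) =
              Real.exp (-D) := by
            rw [← Real.exp_add, ← Real.exp_add]
            ring_nf
          have h2 : Real.exp ((c + 1) * D) * (Real.exp (6 * D) * Real.exp (-((c + 8) * D))) =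
              Real.exp (-D) := by
            rw [← Real.exp_add, ← Real.exp_add]
            ring_nf
          linear_combination 2 * A * h1 + 2 * A * h2
        -- The spare exponent is used here: `D ≥ l ≥ log T`.
        _ ≤ 4 * A * Real.exp (-Real.log T) := by
          gcongr
          linarith
        _ = 4 * A / T := by
          rw [Real.exp_neg, Real.exp_log hT0, div_eq_mul_inv]
    -- After squaring, the balance equation turns the left side into `192 (c + 8) R² t₁³ / n`, with
    -- `192 = 8² · 3`, and `n ≥ t₁` finishes.
    have hρ : √K * (8 * s / n / √C) * T ≤ √(192 * (c + 8)) * (R * t₁) := by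
      refine abs_le_of_sq_le_sq' ?_ (by positivity) |>.2
      have h3 : σ ^ 2 * K * D * T ^ 2 = t₁ ^ 3 * (R ^ 2 * C) := by
        rw [hcube, hD]
        ring
      calc (√K * (8 * s / n / √C) * T) ^ 2
          = √K ^ 2 * (8 ^ 2 * s ^ 2 / n ^ 2 / √C ^ 2) * T ^ 2 := by ring
        _ = 192 * (c + 8) * (σ ^ 2 * K * D * T ^ 2) / (n * C) := by
          rw [hs2, Real.sq_sqrt hK.le, Real.sq_sqrt hC.le]
          field_simp
          ring
        _ = 192 * (c + 8) * R ^ 2 * t₁ ^ 3 / n := by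
          rw [h3]
          field_simp
        _ ≤ 192 * (c + 8) * R ^ 2 * t₁ ^ 3 / t₁ := by gcongr
        _ = (√(192 * (c + 8)) * (R * t₁)) ^ 2 := by
          rw [mul_pow, Real.sq_sqrt (by positivity)]
          field_simp
    have h := run.integral_pseudoRegret_le hνX hstar hR.le hRX
      (by positivity : 0 ≤ √K * (8 * s / n / √C)) hBT hgood
    calc _ ≤ 2 * R * n + 2 * (√K * (8 * s / n / √C)) * T + 2 * R * T * (4 * A / T) := h
      _ = 2 * R * n + 2 * (√K * (8 * s / n / √C) * T) + 8 * A * (R * 1) := by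
        field_simp
        ring
      _ ≤ 2 * R * (2 * t₁) + 2 * (√(192 * (c + 8)) * (R * t₁)) + 8 * A * (R * t₁) := by gcongr
      _ = _ := by ring
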